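/- **Proposition (quantized synchronization of nonlinear passive agents).** Let $G$ be a connected undirected graph with nodes $1,\dots,N$ and edges $1,\dots,M$. Label one end of each edge as positive and the other as negative, and let $D\in\mathbb R^{N\times M}$ be the incidence matrix: $d_{ik}=1$ if node $i$ is the positive end of edge $k$, $d_{ik}=-1$ if it is the negative end, and $d_{ik}=0$ otherwise. For $i=1,\dots,N$ consider the agent $$\dot\xi_i=f_i(\xi_i)+g_i(\xi_i)u_i,\qquad w_i=h_i(\xi_i),\qquad \xi_i\in\mathbb R^{n_i},\ u_i,w_i\in\mathbb R^p,$$ where $f_i,g_i,h_i$ are locally Lipschitz, $f_i(0)=0$, $h_i(0)=0$ and $g_i(0)$ has full column rank. Assume that each agent is passive: there are a continuously differentiable, positive definite, radially unbounded function $S_i:\mathbb R^{n_i}\to[0,\infty)$ and a continuous function $W_i:\mathbb R^{n_i}\to[0,\infty)$ with $W_i(0)=0$ such that $$\nabla S_i(\xi_i)\,\bigl(f_i(\xi_i)+g_i(\xi_i)u_i\bigr)\le -W_i(\xi_i)+h_i(\xi_i)^Tu_i\qquad\text{for all }\xi_i\in\mathbb R^{n_i},\ u_i\in\mathbb R^p.$$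 Let $\Delta>0$, let $q_\Delta(r)=\Delta\lfloor r/\Delta+1/2\rfloor$ act entrywise on vectors, and write $\xi=(\xi_1,\dots,\xi_N)$, $h(\xi)=(h_1(\xi_1),\dots,h_N(\xi_N))$. Close the loop with $$u=-(D\otimes I_p)\,q_\Delta(z),\qquad z=(D^T\otimes I_p)\,h(\xi),$$ and denote the resulting system by $\dot\xi=F(\xi)$. A Krasowskii solution on $[0,T)$, $0<T\le\infty$, is a function that is absolutely continuous on compact subintervals and satisfies $\dot\xi(t)\in\mathcal KF(\xi(t)):=\bigcap_{\delta>0}\overline{\mathrm{co}}\,F(B(\xi(t),\delta))$ for almost every $t\in[0,T)$; it is maximal if it has no extension to a Krasowskii solution on $[0,T')$ with $T'>T$. A set is weakly invariant if from each of its points there starts at least one maximal Krasowskii solution that stays in the set on its whole interval of definition. Then every maximal Krasowskii solution $\xi$ of the closed loop is defined on $[0,\infty)$, and, as $t\to\infty$, $\xi(t)$ converges (in distance) to the largest weakly invariant subset contained in $$\Bigl\{\xi\in\mathbb R^{n_1+\dots+n_N}:\ |z_{kj}|\le\tfrac{\Delta}{2}\ \text{ for all } k=1,\dots,M,\ j=1,\dots,p\Bigr\},\qquad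 z=(D^T\otimes I_p)\,h(\xi).$$ -/

import Mathlib

open scoped Kronecker Matrix

noncomputable section

/-! Vectors are functions `Fin m → ℝ`.  Every notion used below (local Lipschitz continuity,
`C¹` regularity, radial unboundedness, the set-valued map `krasowskii`, absolute continuity,
convergence to a set) depends only on the topology of the finite-dimensional space and not on
the choice of a norm. -/

namespace QuantizedSync

/-! ### Krasowskii solutions and weak invariance -/

section Inclusion

variable {X : Type*} [NormedAddCommGroup X] [NormedSpace ℝ X]

/-- The Krasowskii set-valued map `𝒦F(x) = ⋂_{δ > 0} closure (co (F (B(x, δ))))`. -/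
def krasowskii (F : X → X) (x : X) : Set X :=
  ⋂ (δ : ℝ) (_ : 0 < δ), closure (convexHull ℝ (F '' Metric.ball x δ))

/-- `x` is a Krasowskii solution of `ẋ = F(x)` on the interval `[0, T)`, `0 < T ≤ ∞`:
it is absolutely continuous (on compact subintervals) and `ẋ(t) ∈ 𝒦F(x(t))` for almost every `t`.
The values of `x` outside `[0, T)` are irrelevant. -/
structure IsKrasowskiiSolution (F : X → X) (T : EReal) (x : ℝ → X) : Prop where
  pos : 0 < T
  absCont : ∀ b : ℝ, 0 < b → (b : EReal) < T → AbsolutelyContinuousOnInterval x 0 b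
  inclusion : ∀ᵐ t : ℝ, 0 < t → (t : EReal) < T → ∃ w ∈ krasowskii F (x t), HasDerivAt x w t

/-- A Krasowskii solution on `[0, T)` that has no extension to a Krasowskii solution on a larger
interval `[0, T')`. -/
structure IsMaximalKrasowskiiSolution (F : X → X) (T : EReal) (x : ℝ → X) : Prop where
  isSolution : IsKrasowskiiSolution F T x
  maximal : ∀ (T' : EReal) (y : ℝ → X), IsKrasowskiiSolution F T' y → T ≤ T' →
    (∀ t : ℝ, 0 ≤ t → (t : EReal) < T → y t = x t) → T' = T

/-- `S` is weakly invariant for `ẋ ∈ 𝒦F(x)`: from each point of `S` there starts at least one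
maximal Krasowskii solution that stays in `S` on its whole domain of definition. -/
def IsWeaklyInvariant (F : X → X) (S : Set X) : Prop :=
  ∀ x₀ ∈ S, ∃ (T : EReal) (x : ℝ → X), IsMaximalKrasowskiiSolution F T x ∧ x 0 = x₀ ∧
    ∀ t : ℝ, 0 ≤ t → (t : EReal) < T → x t ∈ S

/-- The largest weakly invariant subset contained in `A`. -/
def largestWeaklyInvariantSubset (F : X → X) (A : Set X) : Set X :=
  ⋃₀ {S | IsWeaklyInvariant F S ∧ S ⊆ A}

theorem isGreatest_largestWeaklyInvariantSubset (F : X → X) (A : Set X) :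
    IsGreatest {S | IsWeaklyInvariant F S ∧ S ⊆ A} (largestWeaklyInvariantSubset F A) := by
  refine ⟨⟨?_, Set.sUnion_subset fun S hS => hS.2⟩, fun S hS => Set.subset_sUnion_of_mem hS⟩
  rintro x₀ ⟨S, hS, hx₀⟩
  obtain ⟨T, x, hx, h0, hmem⟩ := hS.1 x₀ hx₀
  exact ⟨T, x, hx, h0, fun t ht htT => ⟨S, hS, hmem t ht htT⟩⟩

/-- `x(t)` converges to the set `S` as `t → ∞`, i.e. `dist(x(t), S) → 0`
(with the convention `dist(x, ∅) = ∞`). -/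
def ConvergesTo (x : ℝ → X) (S : Set X) : Prop :=
  Filter.Tendsto (fun t => Metric.infEDist (x t) S) Filter.atTop (nhds 0)

end Inclusion

/-! ### The agents -/

/-- Standing assumptions on an agent `ξ̇ = f(ξ) + g(ξ) u`, `w = h(ξ)`: the maps are locally
Lipschitz, `f(0) = 0`, `g(0)` has full column rank and `h(0) = 0`. -/
structure IsAdmissibleAgent {n p : ℕ} (f : (Fin n → ℝ) → (Fin n → ℝ))
    (g : (Fin n → ℝ) → Matrix (Fin n) (Fin p) ℝ) (h : (Fin n → ℝ) → (Fin p → ℝ)) : Prop where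
  lipschitz_f : LocallyLipschitz f
  lipschitz_g : ∀ a b, LocallyLipschitz fun ξ => g ξ a b
  lipschitz_h : LocallyLipschitz h
  f_zero : f 0 = 0
  g_zero : (g 0).rank = p
  h_zero : h 0 = 0

/-- Passivity of an agent: there are a `C¹`, positive definite, radially unbounded storage function
`S` and a continuous non-negative function `W`, zero at the origin, with
`∇S(ξ) (f(ξ) + g(ξ) u) ≤ -W(ξ) + h(ξ)ᵀ u` for all `ξ` and `u`.  A strictly passive agent,
for which `W` is moreover positive away from the origin, is a special case. -/
def IsPassiveAgent {n p : ℕ} (f : (Fin n → ℝ) → (Fin n → ℝ))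
    (g : (Fin n → ℝ) → Matrix (Fin n) (Fin p) ℝ) (h : (Fin n → ℝ) → (Fin p → ℝ)) : Prop :=
  ∃ S W : (Fin n → ℝ) → ℝ,
    ContDiff ℝ 1 S ∧ S 0 = 0 ∧ (∀ ξ, ξ ≠ 0 → 0 < S ξ) ∧
    Filter.Tendsto S (Filter.cocompact (Fin n → ℝ)) Filter.atTop ∧
    Continuous W ∧ (∀ ξ, 0 ≤ W ξ) ∧ W 0 = 0 ∧
    ∀ (ξ : Fin n → ℝ) (u : Fin p → ℝ), fderiv ℝ S ξ (f ξ + g ξ *ᵥ u) ≤ -W ξ + h ξ ⬝ᵥ u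

/-! ### The graph, the quantizer and the closed loop -/

/-- `pos` and `neg` enumerate the edges of the undirected graph `G`, each exactly once, together
with a positive and a negative end: the `k`-th edge joins `pos k` and `neg k`. -/
def IsEdgeLabelling {N M : ℕ} (G : SimpleGraph (Fin N)) (pos neg : Fin M → Fin N) : Prop :=
  Set.BijOn (fun k => s(pos k, neg k)) Set.univ G.edgeSet

/-- The `N × M` incidence matrix of the labelled graph. -/
def incidence {N M : ℕ} (pos neg : Fin M → Fin N) : Matrix (Fin N) (Fin M) ℝ :=
  fun i k => if i = pos k then 1 else if i = neg k then -1 else 0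

/-- The uniform quantizer `q_Δ(r) = Δ ⌊r / Δ + 1 / 2⌋`. -/
def quantizer (Δ r : ℝ) : ℝ := Δ * (⌊r / Δ + 1 / 2⌋ : ℤ)

section ClosedLoop

variable {N M p : ℕ} {n : Fin N → ℕ}

/-- The stacked output `h(ξ) = (h₁(ξ₁), …, h_N(ξ_N)) ∈ ℝ^{Np}`. -/
def stackedOutput (h : ∀ i, (Fin (n i) → ℝ) → (Fin p → ℝ)) (ξ : ∀ i, Fin (n i) → ℝ) :
    Fin N × Fin p → ℝ :=
  fun a => h a.1 (ξ a.1) a.2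

/-- The relative outputs `z = (Dᵀ ⊗ I_p) h(ξ) ∈ ℝ^{Mp}`. -/
def relativeOutput (D : Matrix (Fin N) (Fin M) ℝ) (h : ∀ i, (Fin (n i) → ℝ) → (Fin p → ℝ))
    (ξ : ∀ i, Fin (n i) → ℝ) : Fin M × Fin p → ℝ :=
  (Dᵀ ⊗ₖ (1 : Matrix (Fin p) (Fin p) ℝ)) *ᵥ stackedOutput h ξ

/-- The quantized relative output feedback `u = -(D ⊗ I_p) q_Δ(z) ∈ ℝ^{Np}`, where `q_Δ` acts
entrywise. -/
def quantizedControl (Δ : ℝ) (D : Matrix (Fin N) (Fin M) ℝ)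
    (h : ∀ i, (Fin (n i) → ℝ) → (Fin p → ℝ)) (ξ : ∀ i, Fin (n i) → ℝ) : Fin N × Fin p → ℝ :=
  -((D ⊗ₖ (1 : Matrix (Fin p) (Fin p) ℝ)) *ᵥ fun b => quantizer Δ (relativeOutput D h ξ b))

/-- The right-hand side of the closed loop `ξ̇_i = f_i(ξ_i) + g_i(ξ_i) u_i`, `i = 1, …, N`. -/
def closedLoop (Δ : ℝ) (D : Matrix (Fin N) (Fin M) ℝ)
    (f : ∀ i, (Fin (n i) → ℝ) → (Fin (n i) → ℝ))
    (g : ∀ i, (Fin (n i) → ℝ) → Matrix (Fin (n i)) (Fin p) ℝ)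
    (h : ∀ i, (Fin (n i) → ℝ) → (Fin p → ℝ)) (ξ : ∀ i, Fin (n i) → ℝ) : ∀ i, Fin (n i) → ℝ :=
  fun i => f i (ξ i) + g i (ξ i) *ᵥ fun j => quantizedControl Δ D h ξ (i, j)

/-- The set of states with `|z_{kj}| ≤ Δ / 2` for all edges `k` and components `j`. -/
def practicalSyncSet (Δ : ℝ) (D : Matrix (Fin N) (Fin M) ℝ)
    (h : ∀ i, (Fin (n i) → ℝ) → (Fin p → ℝ)) : Set (∀ i, Fin (n i) → ℝ) :=
  {ξ | ∀ (k : Fin M) (j : Fin p), |relativeOutput D h ξ (k, j)| ≤ Δ / 2}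

end ClosedLoop

end QuantizedSync

end

namespace QuantizedSync

open Filter Topology MeasureTheory Set

open scoped NNReal

/-! ### Absolutely continuous curves -/

/-! The total storage V = ∑ S_i is a Lyapunov function. The feedback and the relative outputs use
transposed incidence factors, so passivity gives dV·F ≤ -∑ z q_Δ(z) over all entries of z. Each term
z q_Δ(z) is nonnegative, and it is at least Δ²/2 once |z| > Δ/2. Although F is discontinuous, it is
locally bounded and V is C¹, so a bound on dV·F near a point passes to 𝒦F there
(`fderiv_le_of_mem_krasowskii`). Hence V never increases along solutions, and it decreases strictly
off the closed set where all |z_kj| ≤ Δ/2.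

The rest is LaSalle's principle for Krasowskii solutions. Radial unboundedness traps the trajectory
in a compact set, so its speed is bounded and a finite T would permit a continuation. The ω-limit
set attracts the trajectory and V is constant on it; weak invariance then forces it into the set
above.

Local existence and weak invariance both need limits of curves, whose derivatives need not converge.
The inclusion is therefore replaced by a condition on slopes: (x t - x s)/(t - s) lies in the closed
convex hull of F(B(x s, δ)) whenever M(t - s) < δ. This condition survives pointwise limits and
returns the inclusion wherever the limit is differentiable (`isKrasowskiiSolution_of_tendsto`). -/

theorem _root_.LipschitzOnWith.comp_absolutelyContinuousOnInterval {X Y : Type*}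
    [PseudoMetricSpace X] [PseudoMetricSpace Y] {K : ℝ≥0} {f : X → Y} {S : Set X} {x : ℝ → X}
    {a b : ℝ} (hf : LipschitzOnWith K f S) (hx : AbsolutelyContinuousOnInterval x a b)
    (hS : MapsTo x (uIcc a b) S) : AbsolutelyContinuousOnInterval (fun t => f (x t)) a b := by
  rw [absolutelyContinuousOnInterval_iff] at hx ⊢
  intro ε hε
  obtain ⟨δ, hδ, H⟩ := hx (ε / (K + 1)) (by positivity)
  refine ⟨δ, hδ, fun E hE hEδ => ?_⟩
  calc
    _ ≤ ∑ i ∈ Finset.range E.1, K * dist (x (E.2 i).1) (x (E.2 i).2) :=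
      Finset.sum_le_sum fun i hi =>
        hf.dist_le_mul _ (hS (hE.1 i hi).1) _ (hS (hE.1 i hi).2)
    _ = K * ∑ i ∈ Finset.range E.1, dist (x (E.2 i).1) (x (E.2 i).2) :=
      (Finset.mul_sum _ _ _).symm
    _ ≤ (K + 1) * ∑ i ∈ Finset.range E.1, dist (x (E.2 i).1) (x (E.2 i).2) := by
      gcongr
      linarith
    _ < (K + 1) * (ε / (K + 1)) := by
      gcongr
      exact H E hE hEδ
    _ = ε := by field_simp

theorem sub_le_mul_of_ae_hasDerivAt_le {g : ℝ → ℝ} {s t u : ℝ} (hst : s ≤ t)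
    (hg : AbsolutelyContinuousOnInterval g s t)
    (h : ∀ᵐ r : ℝ, s < r → r < t → ∃ w ≤ u, HasDerivAt g w r) : g t - g s ≤ u * (t - s) := by
  rw [← hg.integral_deriv_eq_sub]
  have h2 : ∫ r in s..t, deriv g r ≤ ∫ _ in s..t, u := by
    simp only [intervalIntegral.integral_of_le hst, integral_Ioc_eq_integral_Ioo]
    refine setIntegral_mono_on_ae ?_ ?_ measurableSet_Ioo ?_
    · exact (hg.intervalIntegrable_deriv.1).mono_set Ioo_subset_Ioc_self
    · simp
    · filter_upwards [h] with r hr hrm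
      obtain ⟨w, hw, hd⟩ := hr hrm.1 hrm.2
      rwa [hd.deriv]
  simpa [mul_comm] using h2

section Inclusion

variable {X : Type*} [NormedAddCommGroup X] [NormedSpace ℝ X]

/-- Mean value theorem: the slope of an absolutely continuous curve lies in every closed convex set
that contains almost all of its derivatives. -/
theorem slope_mem_of_ae_hasDerivAt {x : ℝ → X} {s t : ℝ} (hst : s < t)
    (hx : AbsolutelyContinuousOnInterval x s t) {C : Set X} (hC : Convex ℝ C) (hC' : IsClosed C)
    (h : ∀ᵐ r : ℝ, s < r → r < t → ∃ w ∈ C, HasDerivAt x w r) :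
    (t - s)⁻¹ • (x t - x s) ∈ C := by
  by_contra hmem
  -- A functional separating the slope from `C` reduces the claim to the real-valued curve φ ∘ x.
  obtain ⟨φ, u, h1, h2⟩ := geometric_hahn_banach_closed_point hC hC' hmem
  have hAC : AbsolutelyContinuousOnInterval (fun r => φ (x r)) s t :=
    (φ.lipschitz.lipschitzOnWith (s := univ)).comp_absolutelyContinuousOnInterval hx
      (mapsTo_univ _ _)
  have h3 := sub_le_mul_of_ae_hasDerivAt_le hst.le hAC (u := u) <| by
    filter_upwards [h] with r hr hsr hrt
    obtain ⟨w, hw, hd⟩ := hr hsr hrt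
    exact ⟨φ w, (h1 w hw).le, φ.hasFDerivAt.comp_hasDerivAt r hd⟩
  have hpos : 0 < t - s := sub_pos.2 hst
  rw [map_smul, map_sub, smul_eq_mul, lt_inv_mul_iff₀ hpos] at h2
  linarith

theorem dist_le_of_ae_hasDerivAt {x : ℝ → X} {s t M : ℝ} (hst : s ≤ t)
    (hx : AbsolutelyContinuousOnInterval x s t)
    (h : ∀ᵐ r : ℝ, s < r → r < t → ∃ w, ‖w‖ ≤ M ∧ HasDerivAt x w r) :
    dist (x t) (x s) ≤ M * (t - s) := by
  rcases hst.eq_or_lt with rfl | hst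
  · simp
  have h1 := slope_mem_of_ae_hasDerivAt hst hx (convex_closedBall (0 : X) M)
    Metric.isClosed_closedBall (by simpa using h)
  have hpos : 0 < t - s := sub_pos.2 hst
  rw [mem_closedBall_zero_iff, norm_smul, norm_inv, Real.norm_of_nonneg hpos.le,
    inv_mul_le_iff₀ hpos] at h1
  rw [dist_eq_norm]
  linarith

/-! ### The Krasowskii map -/

theorem krasowskii_subset (F : X → X) {x y : X} {δ : ℝ} (h : dist x y < δ) :
    krasowskii F x ⊆ closure (convexHull ℝ (F '' Metric.ball y δ)) := by
  refine (iInter₂_subset (δ - dist x y) (sub_pos.2 h)).trans ?_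
  refine closure_mono (convexHull_mono (image_mono (Metric.ball_subset_ball' ?_)))
  linarith

theorem le_of_mem_krasowskii {F : X → X} {x v : X} (hv : v ∈ krasowskii F x) (φ : X →L[ℝ] ℝ)
    {c : ℝ} (h : ∀ᶠ y in 𝓝 x, φ (F y) ≤ c) : φ v ≤ c := by
  obtain ⟨δ, hδ, H⟩ := Metric.eventually_nhds_iff_ball.1 h
  have hcl : IsClosed {w | φ w ≤ c} := isClosed_le φ.continuous continuous_const
  have hco : Convex ℝ {w | φ w ≤ c} := convex_halfSpace_le φ.isLinear c
  have hsub : closure (convexHull ℝ (F '' Metric.ball x δ)) ⊆ {w | φ w ≤ c} :=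
    closure_minimal (convexHull_min (by rintro _ ⟨y, hy, rfl⟩; exact H y hy) hco) hcl
  exact hsub (mem_iInter₂.1 hv δ hδ)

theorem norm_le_of_mem_krasowskii {F : X → X} {x v : X} (hv : v ∈ krasowskii F x) {M : ℝ}
    (h : ∀ᶠ y in 𝓝 x, ‖F y‖ ≤ M) : ‖v‖ ≤ M := by
  obtain ⟨δ, hδ, H⟩ := Metric.eventually_nhds_iff_ball.1 h
  have hsub : closure (convexHull ℝ (F '' Metric.ball x δ)) ⊆ Metric.closedBall 0 M :=
    closure_minimal (convexHull_min (by rintro _ ⟨y, hy, rfl⟩; simpa using H y hy)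
      (convex_closedBall _ _)) Metric.isClosed_closedBall
  simpa using hsub (mem_iInter₂.1 hv δ hδ)

/-- A decay estimate for `V` along `F` near `x` passes to `𝒦F(x)`. -/
theorem fderiv_le_of_mem_krasowskii {F : X → X} {V : X → ℝ} (hV : ContDiff ℝ 1 V) {x v : X}
    (hv : v ∈ krasowskii F x) {c M : ℝ} (hM : ∀ᶠ y in 𝓝 x, ‖F y‖ ≤ M)
    (h : ∀ᶠ y in 𝓝 x, fderiv ℝ V y (F y) ≤ c) : fderiv ℝ V x v ≤ c := by
  have hM0 : 0 ≤ M := (norm_nonneg _).trans hM.self_of_nhds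
  -- Convex hulls preserve only inequalities for one fixed functional, so the derivative is frozen
  -- at `x`, at a cost of ε.
  refine le_of_forall_pos_le_add fun ε hε => le_of_mem_krasowskii hv _ ?_
  have hc : ContinuousAt (fderiv ℝ V) x := (hV.continuous_fderiv one_ne_zero).continuousAt
  filter_upwards [hM, h, Metric.tendsto_nhds.1 hc (ε / (M + 1)) (by positivity)] with y h1 h2 h3
  have h4 : fderiv ℝ V x (F y) - fderiv ℝ V y (F y) ≤ ε / (M + 1) * M := by
    rw [← sub_apply]
    refine (Real.le_norm_self _).trans ((ContinuousLinearMap.le_opNorm _ _).trans ?_)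
    rw [dist_comm, dist_eq_norm] at h3
    gcongr
  have h5 : ε / (M + 1) * M ≤ ε := by
    rw [div_mul_eq_mul_div, div_le_iff₀ (by positivity)]
    nlinarith
  linarith

/-- Used for compactness of families of curves: along one ultrafilter the values at all times
converge at once, with no diagonal extraction. -/
theorem _root_.IsCompact.exists_tendsto_ultrafilter {α ι : Type*} [TopologicalSpace α] {K : Set α}
    (hK : IsCompact K) {U : Ultrafilter ι} {x : ι → α} (h : ∀ᶠ i in U, x i ∈ K) :
    ∃ p, Tendsto x U (𝓝 p) := by
  obtain ⟨p, -, hp⟩ := hK.ultrafilter_le_nhds (U.map x) (le_principal_iff.2 h)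
  exact ⟨p, hp⟩

/-! ### Limits of approximate solutions -/

/-- A Lipschitz pointwise limit of curves whose slopes lie approximately in the Krasowskii hulls is a
Krasowskii solution. -/
theorem isKrasowskiiSolution_of_tendsto [FiniteDimensional ℝ X] {F : X → X} {T : EReal} (hT : 0 < T)
    {ι : Type*} {U : Filter ι} [U.NeBot] {x : ι → ℝ → X} {y : ℝ → X} {M : ℝ≥0}
    (hlim : ∀ t : ℝ, 0 ≤ t → (t : EReal) < T → Tendsto (fun i => x i t) U (𝓝 (y t)))
    (hlip : ∀ s t : ℝ, 0 ≤ s → s ≤ t → (t : EReal) < T →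
      ∀ᶠ i in U, dist (x i t) (x i s) ≤ M * (t - s))
    (hslope : ∀ s t : ℝ, 0 ≤ s → s < t → (t : EReal) < T → ∀ δ : ℝ, M * (t - s) < δ →
      ∀ᶠ i in U, (t - s)⁻¹ • (x i t - x i s) ∈
        closure (convexHull ℝ (F '' Metric.ball (x i s) δ))) :
    LipschitzOnWith M y {t : ℝ | 0 ≤ t ∧ (t : EReal) < T} ∧ IsKrasowskiiSolution F T y := by
  have hltT : ∀ {s t : ℝ}, s ≤ t → (t : EReal) < T → (s : EReal) < T := fun h h' =>
    lt_of_le_of_lt (EReal.coe_le_coe_iff.2 h) h'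
  have hylip : ∀ s t : ℝ, 0 ≤ s → s ≤ t → (t : EReal) < T → dist (y t) (y s) ≤ M * (t - s) :=
    fun s t hs hst ht => le_of_tendsto
      ((hlim t (hs.trans hst) ht).dist (hlim s hs (hltT hst ht))) (hlip s t hs hst ht)
  have hyL : LipschitzOnWith M y {t : ℝ | 0 ≤ t ∧ (t : EReal) < T} := by
    refine LipschitzOnWith.of_dist_le_mul fun s hs t ht => ?_
    rcases le_total s t with hst | hst
    · rw [dist_comm, dist_comm s, Real.dist_eq, abs_of_nonneg (sub_nonneg.2 hst)]
      exact hylip s t hs.1 hst ht.2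
    · rw [Real.dist_eq, abs_of_nonneg (sub_nonneg.2 hst)]
      exact hylip t s ht.1 hst hs.2
  have hyslope : ∀ s t : ℝ, 0 ≤ s → s < t → (t : EReal) < T → ∀ δ : ℝ, M * (t - s) < δ →
      (t - s)⁻¹ • (y t - y s) ∈ closure (convexHull ℝ (F '' Metric.ball (y s) δ)) := by
    intro s t hs hst ht δ hδ
    -- The gap δ - δ' absorbs the displacement of the centre from `x i s` to `y s`.
    obtain ⟨δ', h1, h2⟩ := exists_between hδ
    refine isClosed_closure.mem_of_tendsto (b := U)
      (((hlim t (hs.trans hst.le) ht).sub (hlim s hs (hltT hst.le ht))).const_smul _) ?_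
    filter_upwards [hslope s t hs hst ht δ' h1,
      Metric.tendsto_nhds.1 (hlim s hs (hltT hst.le ht)) (δ - δ') (sub_pos.2 h2)] with i hi hd
    refine closure_mono (convexHull_mono (image_mono (Metric.ball_subset_ball' ?_))) hi
    linarith
  refine ⟨hyL, hT, fun b hb hbT => ?_, ?_⟩
  · refine (hyL.mono fun r hr => ?_).absolutelyContinuousOnInterval
    rw [uIcc_of_le hb.le] at hr
    exact ⟨hr.1, hltT hr.2 hbT⟩
  -- Rademacher's theorem supplies the derivative; for each δ, slopes over short enough intervals to
  -- the right of `t` lie in the δ-hull.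
  · filter_upwards [hyL.ae_differentiableWithinAt_of_mem_real] with t hd ht htT
    have hIT : {r : ℝ | (r : EReal) < T} ∈ 𝓝 t :=
      (isOpen_Iio.preimage continuous_coe_real_ereal).mem_nhds htT
    have hnhds : {t : ℝ | 0 ≤ t ∧ (t : EReal) < T} ∈ 𝓝 t := by
      filter_upwards [lt_mem_nhds ht, hIT] with r h1 h2 using ⟨h1.le, h2⟩
    have hda := ((hd ⟨ht.le, htT⟩).differentiableAt hnhds).hasDerivAt
    refine ⟨deriv y t, mem_iInter₂.2 fun δ hδ => ?_, hda⟩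
    have hs := (hasDerivAt_iff_tendsto_slope.1 hda).mono_left
      (nhdsWithin_mono t (fun r (hr : r ∈ Ioi t) => (ne_of_gt hr : r ≠ t)))
    refine isClosed_closure.mem_of_tendsto hs ?_
    have hsmall : ∀ᶠ r in 𝓝 t, M * (r - t) < δ := by
      have : Tendsto (fun r => (M : ℝ) * (r - t)) (𝓝 t) (𝓝 (M * (t - t))) :=
        (continuous_const.mul (continuous_id.sub continuous_const)).tendsto t
      exact this.eventually_lt_const (by simpa using hδ)
    filter_upwards [self_mem_nhdsWithin, nhdsWithin_le_nhds hsmall, nhdsWithin_le_nhds hIT]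
      with r h1 h2 h3
    rw [slope_def_module]
    exact hyslope t r ht.le h1 h3 δ h2

/-! ### Local existence -/

/-- A partition of unity glues local constants: the value `F x` is admissible at every `y` with `x ∈
B(y, ε)`. -/
theorem exists_contDiff_mem_convexHull [FiniteDimensional ℝ X] (F : X → X) {ε : ℝ} (hε : 0 < ε) :
    ∃ Φ : X → X, ContDiff ℝ 1 Φ ∧ ∀ x, Φ x ∈ convexHull ℝ (F '' Metric.ball x ε) := by
  obtain ⟨Φ, hΦ⟩ := exists_contMDiffMap_forall_mem_convex_of_local_const (n := 1)
    (modelWithCornersSelf ℝ X) (t := fun x => convexHull ℝ (F '' Metric.ball x ε))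
    (fun x => convex_convexHull ℝ _) (fun x => ⟨F x, by
      filter_upwards [Metric.ball_mem_nhds x hε] with y hy
      exact subset_convexHull ℝ _ ⟨x, by rwa [Metric.mem_ball'], rfl⟩⟩)
  exact ⟨Φ, Φ.contMDiff.contDiff, hΦ⟩

/-- The smooth selection Φ is Lipschitz on the closed unit ball about `x₀`, and M τ ≤ 1 keeps its
Picard–Lindelöf solution there up to time τ. Values of Φ in that ball average `F` over points within
1 + ε < 2 of `x₀`, hence the radius 2 in `hM`. -/
theorem exists_approximate_solution [FiniteDimensional ℝ X] {F : X → X} {x₀ : X} {M : ℝ≥0}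
    {τ ε : ℝ} (hτ : 0 < τ) (hMτ : M * τ ≤ 1) (hε : 0 < ε) (hε1 : ε < 1)
    (hM : ∀ x, dist x x₀ ≤ 2 → ‖F x‖ ≤ M) :
    ∃ x : ℝ → X, x 0 = x₀ ∧
      (∀ s t : ℝ, 0 ≤ s → s ≤ t → t ≤ τ → dist (x t) (x s) ≤ M * (t - s)) ∧
      ∀ s t : ℝ, 0 ≤ s → s < t → t ≤ τ → ∀ δ : ℝ, M * (t - s) + ε ≤ δ →
        (t - s)⁻¹ • (x t - x s) ∈ closure (convexHull ℝ (F '' Metric.ball (x s) δ)) := by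
  obtain ⟨Φ, hΦ, hmem⟩ := exists_contDiff_mem_convexHull F hε
  have hbound : ∀ x ∈ Metric.closedBall x₀ (1 : ℝ≥0), ‖Φ x‖ ≤ M := by
    intro x hx
    have : convexHull ℝ (F '' Metric.ball x ε) ⊆ Metric.closedBall 0 M := by
      refine convexHull_min ?_ (convex_closedBall _ _)
      rintro _ ⟨y, hy, rfl⟩
      rw [mem_closedBall_zero_iff]
      refine hM y ?_
      rw [Metric.mem_closedBall, NNReal.coe_one] at hx
      rw [Metric.mem_ball] at hy
      linarith [dist_triangle y x x₀]
    simpa using this (hmem x)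
  obtain ⟨K, hK⟩ := (hΦ.contDiffOn (s := Metric.closedBall x₀ (1 : ℝ≥0))).exists_lipschitzOnWith
    (by decide) (convex_closedBall _ _) (isCompact_closedBall _ _)
  have hPL : IsPicardLindelof (fun _ : ℝ => Φ) (⟨0, le_rfl, hτ.le⟩ : Icc (0 : ℝ) τ) x₀ 1 0 M K := by
    refine ⟨fun _ _ => hK, fun _ _ => continuousOn_const, fun _ _ => hbound, ?_⟩
    simpa [hτ.le] using hMτ
  -- The fixed point itself is kept, since membership in the function space confines its values to
  -- the unit ball.
  obtain ⟨α, hα⟩ := ODE.FunSpace.exists_isFixedPt_next hPL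
    (Metric.mem_closedBall_self (NNReal.coe_nonneg 0))
  set x : ℝ → X := α.compProj with hx
  have hball : ∀ t, x t ∈ Metric.closedBall x₀ (1 : ℝ≥0) := fun t =>
    α.compProj_mem_closedBall hPL.mul_max_le
  have hderiv : ∀ t ∈ Icc (0 : ℝ) τ, HasDerivWithinAt x (Φ (x t)) (Icc 0 τ) t := by
    intro t ht
    refine ODE.hasDerivWithinAt_picard_Icc (⟨0, le_rfl, hτ.le⟩ : Icc (0 : ℝ) τ).2
      hPL.continuousOn_uncurry α.continuous_compProj.continuousOn (fun t _ => hball t) x₀ ht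
      |>.congr_of_mem (fun t' ht' => ?_) ht
    nth_rw 1 [hx, ← hα]
    rw [ODE.FunSpace.compProj_of_mem ht', ODE.FunSpace.next_apply]
  have hderiv' : ∀ t, 0 < t → t < τ → HasDerivAt x (Φ (x t)) t := fun t h0 h1 =>
    (hderiv t ⟨h0.le, h1.le⟩).hasDerivAt (Icc_mem_nhds h0 h1)
  have hAC : ∀ s t : ℝ, 0 ≤ s → s ≤ t → t ≤ τ → AbsolutelyContinuousOnInterval x s t := by
    intro s t hs hst ht
    have hI : uIcc s t ⊆ Icc 0 τ := by
      rw [uIcc_of_le hst]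
      exact Icc_subset_Icc hs ht
    refine LipschitzOnWith.absolutelyContinuousOnInterval (K := M) (LipschitzOnWith.mono ?_ hI)
    exact (convex_Icc (0 : ℝ) τ).lipschitzOnWith_of_nnnorm_hasDerivWithin_le hderiv
      fun t _ => hbound _ (hball t)
  have hlip : ∀ s t : ℝ, 0 ≤ s → s ≤ t → t ≤ τ → dist (x t) (x s) ≤ M * (t - s) := by
    intro s t hs hst ht
    refine dist_le_of_ae_hasDerivAt hst (hAC s t hs hst ht) (Eventually.of_forall fun r h1 h2 => ?_)
    exact ⟨_, hbound _ (hball r), hderiv' r (hs.trans_lt h1) (h2.trans_le ht)⟩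
  refine ⟨x, ?_, hlip, fun s t hs hst ht δ hδ => ?_⟩
  · have h0 := ODE.FunSpace.compProj_of_mem (α := α) (t := 0) ⟨le_rfl, hτ.le⟩
    rw [hx, h0]
    exact α.apply_of_zero
  · refine slope_mem_of_ae_hasDerivAt hst (hAC s t hs hst.le ht) (convex_convexHull ℝ _).closure
      isClosed_closure (Eventually.of_forall fun r h1 h2 => ?_)
    refine ⟨_, ?_, hderiv' r (hs.trans_lt h1) (h2.trans_le ht)⟩
    -- The curve moves at most M(t - s) away from `x s`, and the smoothing reaches ε further.
    refine subset_closure (convexHull_mono (image_mono (Metric.ball_subset_ball' ?_)) (hmem (x r)))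
    have h3 := hlip s r hs h1.le (h2.le.trans ht)
    have h4 : (M : ℝ) * (r - s) ≤ M * (t - s) := by gcongr
    linarith

/-- Local existence of Krasowskii solutions. -/
theorem exists_isKrasowskiiSolution [FiniteDimensional ℝ X] {F : X → X} {x₀ : X} {M : ℝ≥0}
    (hM : ∀ x, dist x x₀ ≤ 2 → ‖F x‖ ≤ M) :
    ∃ (τ : ℝ) (y : ℝ → X), LipschitzOnWith M y {t : ℝ | 0 ≤ t ∧ (t : EReal) < τ} ∧
      IsKrasowskiiSolution F τ y ∧ y 0 = x₀ := by
  have hτ : (0 : ℝ) < 1 / (M + 1) := by positivity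
  have hMτ : (M : ℝ) * (1 / (M + 1)) ≤ 1 := by
    rw [mul_one_div, div_le_one (by positivity)]
    linarith
  set τ : ℝ := 1 / (M + 1) with hτdef
  have hε : ∀ i : ℕ, (0 : ℝ) < 1 / ((i : ℝ) + 2) := fun i => by positivity
  have hε1 : ∀ i : ℕ, 1 / ((i : ℝ) + 2) < 1 := fun i => by
    rw [div_lt_one (by positivity)]
    linarith [(Nat.cast_nonneg i : (0 : ℝ) ≤ i)]
  choose x hx0 hlip hslope using fun i : ℕ => exists_approximate_solution hτ hMτ (hε i) (hε1 i) hM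
  let U : Ultrafilter ℕ := Ultrafilter.of atTop
  have hU : (U : Filter ℕ) ≤ atTop := Ultrafilter.of_le atTop
  have hconv : ∀ t : ℝ, ∃ p, 0 ≤ t → t ≤ τ → Tendsto (fun i => x i t) U (𝓝 p) := by
    intro t
    by_cases ht : 0 ≤ t ∧ t ≤ τ
    · have hmem : ∀ i, x i t ∈ Metric.closedBall x₀ (M * t) := fun i => by
        simpa [hx0] using hlip i 0 t le_rfl ht.1 ht.2
      obtain ⟨p, hp⟩ := (isCompact_closedBall x₀ (M * t)).exists_tendsto_ultrafilter
        (U := U) (Eventually.of_forall hmem)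
      exact ⟨p, fun _ _ => hp⟩
    · exact ⟨0, fun h1 h2 => absurd ⟨h1, h2⟩ ht⟩
  choose y hy using hconv
  have hsol := isKrasowskiiSolution_of_tendsto (F := F) (T := τ) (by exact_mod_cast hτ)
    (U := (U : Filter ℕ)) (x := x) (y := y) (M := M) ?_ ?_ ?_
  · refine ⟨τ, y, hsol.1, hsol.2, ?_⟩
    have h := hy 0 le_rfl hτ.le
    simp only [hx0] at h
    exact tendsto_nhds_unique h tendsto_const_nhds
  · exact fun t ht htτ => hy t ht (EReal.coe_lt_coe_iff.1 htτ).le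
  · exact fun s t hs hst ht => Eventually.of_forall fun i =>
      hlip i s t hs hst (EReal.coe_lt_coe_iff.1 ht).le
  · intro s t hs hst ht δ hδ
    have hε0 : Tendsto (fun i : ℕ => 1 / ((i : ℝ) + 2)) atTop (𝓝 0) := by
      simp only [one_div]
      exact tendsto_inv_atTop_zero.comp
        (tendsto_atTop_add_const_right _ _ tendsto_natCast_atTop_atTop)
    filter_upwards [hU (hε0.eventually_lt_const (sub_pos.2 hδ))] with i hi
    exact hslope i s t hs hst (EReal.coe_lt_coe_iff.1 ht).le δ (by linarith)

/-! ### Properties of Krasowskii solutions -/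

namespace IsKrasowskiiSolution

variable {F : X → X} {T : EReal} {x : ℝ → X}

theorem absolutelyContinuous (hx : IsKrasowskiiSolution F T x) {s t : ℝ} (hs : 0 ≤ s) (hst : s ≤ t)
    (ht : (t : EReal) < T) : AbsolutelyContinuousOnInterval x s t := by
  -- An endpoint strictly beyond `t` also covers t = 0, where `absCont` says nothing.
  obtain ⟨b, htb, hbT⟩ := EReal.lt_iff_exists_real_btwn.1 ht
  have htb' : t < b := EReal.coe_lt_coe_iff.1 htb
  refine (hx.absCont b ((hs.trans hst).trans_lt htb') hbT).mono ?_
  rw [uIcc_of_le hst, uIcc_of_le ((hs.trans hst).trans htb'.le)]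
  exact Icc_subset_Icc hs htb'.le

theorem ae_hasDerivAt (hx : IsKrasowskiiSolution F T x) {s t : ℝ} (hs : 0 ≤ s)
    (ht : (t : EReal) < T) :
    ∀ᵐ r : ℝ, s < r → r < t → ∃ w ∈ krasowskii F (x r), HasDerivAt x w r := by
  filter_upwards [hx.inclusion] with r hr h1 h2
  exact hr (hs.trans_lt h1) ((EReal.coe_lt_coe_iff.2 h2).trans ht)

theorem dist_le (hx : IsKrasowskiiSolution F T x) {s t M : ℝ} (hs : 0 ≤ s) (hst : s ≤ t)
    (ht : (t : EReal) < T)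
    (hM : ∀ r : ℝ, 0 ≤ r → (r : EReal) < T → ∀ᶠ y in 𝓝 (x r), ‖F y‖ ≤ M) :
    dist (x t) (x s) ≤ M * (t - s) := by
  refine dist_le_of_ae_hasDerivAt hst (hx.absolutelyContinuous hs hst ht) ?_
  filter_upwards [hx.ae_hasDerivAt hs ht] with r hr h1 h2
  obtain ⟨w, hw, hd⟩ := hr h1 h2
  exact ⟨w, norm_le_of_mem_krasowskii hw
    (hM r (hs.trans h1.le) ((EReal.coe_lt_coe_iff.2 h2).trans ht)), hd⟩

/-- Up to time `t` the solution stays within M(t - s) < δ of `x s`, so its derivatives lie in the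
δ-hull. This makes exact solutions eligible for `isKrasowskiiSolution_of_tendsto`. -/
theorem slope_mem (hx : IsKrasowskiiSolution F T x) {s t M δ : ℝ} (hs : 0 ≤ s) (hst : s < t)
    (ht : (t : EReal) < T)
    (hM : ∀ r : ℝ, 0 ≤ r → (r : EReal) < T → ∀ᶠ y in 𝓝 (x r), ‖F y‖ ≤ M)
    (hδ : M * (t - s) < δ) :
    (t - s)⁻¹ • (x t - x s) ∈ closure (convexHull ℝ (F '' Metric.ball (x s) δ)) := by
  refine slope_mem_of_ae_hasDerivAt hst (hx.absolutelyContinuous hs hst.le ht)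
    (convex_convexHull ℝ _).closure isClosed_closure ?_
  filter_upwards [hx.ae_hasDerivAt hs ht] with r hr h1 h2
  obtain ⟨w, hw, hd⟩ := hr h1 h2
  refine ⟨w, krasowskii_subset F ?_ hw, hd⟩
  have hrT : (r : EReal) < T := (EReal.coe_lt_coe_iff.2 h2).trans ht
  have hM0 : 0 ≤ M := (norm_nonneg _).trans (hM s hs
    ((EReal.coe_lt_coe_iff.2 hst).trans ht)).self_of_nhds
  have h3 := hx.dist_le hs h1.le hrT hM
  have h4 : M * (r - s) ≤ M * (t - s) := by gcongr
  linarith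

theorem absolutelyContinuous_comp [FiniteDimensional ℝ X] (hx : IsKrasowskiiSolution F T x)
    {V : X → ℝ} (hV : ContDiff ℝ 1 V) {s t : ℝ} (hs : 0 ≤ s) (hst : s ≤ t) (ht : (t : EReal) < T) :
    AbsolutelyContinuousOnInterval (fun r => V (x r)) s t := by
  have hAC := hx.absolutelyContinuous hs hst ht
  obtain ⟨C, hC⟩ := hAC.exists_bound
  obtain ⟨K, hK⟩ := (hV.contDiffOn (s := Metric.closedBall (0 : X) C)).exists_lipschitzOnWith
    one_ne_zero (convex_closedBall _ _) (isCompact_closedBall _ _)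
  exact hK.comp_absolutelyContinuousOnInterval hAC fun r hr => by simpa using hC r hr

/-- A Lyapunov function does not increase along Krasowskii solutions. -/
theorem lyapunov_le [FiniteDimensional ℝ X] (hx : IsKrasowskiiSolution F T x)
    {V : X → ℝ} (hV : ContDiff ℝ 1 V) (hdec : ∀ y, ∀ v ∈ krasowskii F y, fderiv ℝ V y v ≤ 0)
    {s t : ℝ} (hs : 0 ≤ s) (hst : s ≤ t) (ht : (t : EReal) < T) : V (x t) ≤ V (x s) := by
  have h := sub_le_mul_of_ae_hasDerivAt_le (u := 0) hst
    (hx.absolutelyContinuous_comp hV hs hst ht) <| by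
      filter_upwards [hx.ae_hasDerivAt hs ht] with r hr h1 h2
      obtain ⟨w, hw, hd⟩ := hr h1 h2
      exact ⟨_, hdec _ w hw,
        ((hV.differentiable one_ne_zero).differentiableAt.hasFDerivAt).comp_hasDerivAt r hd⟩
  linarith

/-- If a Lyapunov function is constant along a Krasowskii solution, the solution starts in
each closed set outside of which the function decreases strictly. -/
theorem mem_of_lyapunov_const (hx : IsKrasowskiiSolution F T x)
    {V : X → ℝ} (hV : ContDiff ℝ 1 V) {A : Set X} (hA : IsClosed A)
    (hdec : ∀ y ∉ A, ∀ v ∈ krasowskii F y, fderiv ℝ V y v < 0) {c : ℝ}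
    (hc : ∀ r : ℝ, 0 < r → (r : EReal) < T → V (x r) = c) : x 0 ∈ A := by
  obtain ⟨b, h0b, hbT⟩ := EReal.lt_iff_exists_real_btwn.1 hx.pos
  have hb : 0 < b := by exact_mod_cast h0b
  have hae : ∀ᵐ r : ℝ, 0 < r → r < b → x r ∈ A := by
    filter_upwards [hx.ae_hasDerivAt le_rfl hbT] with r hr h1 h2
    by_contra hmem
    obtain ⟨w, hw, hd⟩ := hr h1 h2
    have hd1 := ((hV.differentiable one_ne_zero).differentiableAt.hasFDerivAt).comp_hasDerivAt r hd
    have hd2 : HasDerivAt (V ∘ x) 0 r := by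
      refine (hasDerivAt_const r c).congr_of_eventuallyEq ?_
      filter_upwards [Ioo_mem_nhds h1 h2] with r' hr'
      exact hc r' hr'.1 ((EReal.coe_lt_coe_iff.2 hr'.2).trans hbT)
    exact (hdec _ hmem w hw).ne (hd1.unique hd2)
  have hcont : ContinuousWithinAt x (Ioo 0 b) 0 :=
    ((hx.absolutelyContinuous le_rfl hb.le hbT).continuousOn 0 (by simp)).mono
      (by rw [uIcc_of_le hb.le]; exact Ioo_subset_Icc_self)
  -- Times of full measure are dense, so 0 is a limit of times in (0, b) at which `x` lies in the
  -- closed set `A`.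
  have hD := Measure.dense_of_ae hae
  have h0 : (0 : ℝ) ∈ closure (Ioo 0 b ∩ {r : ℝ | 0 < r → r < b → x r ∈ A}) := by
    refine closure_minimal (hD.open_subset_closure_inter isOpen_Ioo) isClosed_closure ?_
    rw [closure_Ioo hb.ne]
    exact ⟨le_rfl, hb.le⟩
  have h1 := (hcont.mono inter_subset_left).mem_closure h0 (fun r hr => hr.2 hr.1.1 hr.1.2)
  rwa [hA.closure_eq] at h1

end IsKrasowskiiSolution

/-- A maximal Krasowskii solution of bounded speed is defined for all positive times. -/
theorem IsMaximalKrasowskiiSolution.eq_top [FiniteDimensional ℝ X] {F : X → X} {T : EReal}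
    {x : ℝ → X} (hx : IsMaximalKrasowskiiSolution F T x)
    (hF : ∀ R : ℝ, ∃ M : ℝ≥0, ∀ y, ‖y‖ ≤ R → ‖F y‖ ≤ M) {M : ℝ≥0}
    (hM : ∀ r : ℝ, 0 ≤ r → (r : EReal) < T → ∀ᶠ y in 𝓝 (x r), ‖F y‖ ≤ M) : T = ⊤ := by
  by_contra hT
  have hsol := hx.isSolution
  lift T to ℝ using ⟨hT, ne_bot_of_gt hsol.pos⟩
  have hT0 : 0 < T := by exact_mod_cast hsol.pos
  have hL : LipschitzOnWith M x (Ico 0 T) := by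
    refine LipschitzOnWith.of_dist_le_mul fun s hs t ht => ?_
    rcases le_total s t with hst | hst
    · rw [dist_comm, dist_comm s, Real.dist_eq, abs_of_nonneg (sub_nonneg.2 hst)]
      exact hsol.dist_le hs.1 hst (EReal.coe_lt_coe_iff.2 ht.2) hM
    · rw [Real.dist_eq, abs_of_nonneg (sub_nonneg.2 hst)]
      exact hsol.dist_le ht.1 hst (EReal.coe_lt_coe_iff.2 hs.2) hM
  -- The Lipschitz extension provides the missing value at time `T`, from which a local solution is
  -- restarted.
  obtain ⟨y, hyL, hxy⟩ := hL.extend_finite_dimension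
  obtain ⟨M', hM'⟩ := hF (‖y T‖ + 2)
  obtain ⟨τ, z, hzL, hz, hz0⟩ := exists_isKrasowskiiSolution (F := F) (x₀ := y T) (M := M') <| by
    intro w hw
    refine hM' w ?_
    have := norm_le_norm_add_norm_sub (y T) w
    rw [← dist_eq_norm, dist_comm] at this
    linarith
  have hτ : 0 < τ := by exact_mod_cast hz.pos
  obtain ⟨z', hz'L, hzz'⟩ := hzL.extend_finite_dimension
  have hz'0 : z' 0 = y T := by
    rw [← hzz' ⟨le_rfl, by exact_mod_cast hτ⟩, hz0]
  -- Clipping the times makes the concatenation globally Lipschitz, so absolute continuity across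
  -- `T` is immediate.
  set w : ℝ → X := fun t => y (min t T) + (z' (max (t - T) 0) - z' 0) with hw
  have hwL : ∃ K, LipschitzWith K w :=
    ⟨_, (hyL.comp (LipschitzWith.id.min_const T)).add
      ((hz'L.comp ((LipschitzWith.id.sub (LipschitzWith.const T)).max_const 0)).sub
        (LipschitzWith.const (z' 0)))⟩
  obtain ⟨K, hK⟩ := hwL
  have hwx : ∀ t, 0 ≤ t → t < T → w t = x t := fun t h0 h1 => by
    simp [hw, h1.le, hxy ⟨h0, h1⟩]
  have hwz : ∀ t, T ≤ t → t < T + τ → w t = z (t - T) := fun t h0 h1 => by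
    have h2 : z (t - T) = z' (t - T) :=
      hzz' ⟨sub_nonneg.2 h0, EReal.coe_lt_coe_iff.2 (by linarith)⟩
    simp [hw, h0, hz'0, h2]
  have hwsol : IsKrasowskiiSolution F ((T + τ : ℝ) : EReal) w := by
    refine ⟨by exact_mod_cast (by positivity : 0 < T + τ),
      fun b _ _ => hK.lipschitzOnWith.absolutelyContinuousOnInterval, ?_⟩
    have hne : ∀ᵐ r : ℝ, r ≠ T := by simp [ae_iff, measure_singleton]
    filter_upwards [hsol.inclusion, hne,
      (measurePreserving_sub_right volume T).quasiMeasurePreserving.ae hz.inclusion]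
      with r h1 h2 h3 hr0 hr1
    replace hr1 : r < T + τ := EReal.coe_lt_coe_iff.1 hr1
    rcases lt_or_gt_of_ne h2 with hr | hr
    · rw [hwx r hr0.le hr]
      obtain ⟨v, hv, hd⟩ := h1 hr0 (EReal.coe_lt_coe_iff.2 hr)
      refine ⟨v, hv, hd.congr_of_eventuallyEq ?_⟩
      filter_upwards [Ioo_mem_nhds hr0 hr] with r' hr' using hwx r' hr'.1.le hr'.2
    · rw [hwz r hr.le hr1]
      obtain ⟨v, hv, hd⟩ := h3 (sub_pos.2 hr) (EReal.coe_lt_coe_iff.2 (by linarith))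
      refine ⟨v, hv, (hd.comp_sub_const r T).congr_of_eventuallyEq ?_⟩
      filter_upwards [Ioo_mem_nhds hr hr1] with r' hr' using hwz r' hr'.1.le hr'.2
  have h := hx.maximal _ w hwsol (EReal.coe_le_coe_iff.2 (by linarith))
    fun t h0 h1 => hwx t h0 (EReal.coe_lt_coe_iff.1 h1)
  have h' : T + τ = T := by exact_mod_cast h
  linarith

/-! ### The invariance principle -/

/-- The time shifts x(i + ·) share one Lipschitz bound and stay in `K`. Their limit along an
ultrafilter realizing `p` is the required solution, and each of its values is a limit of `x` along a
shifted ultrafilter. -/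
theorem exists_isKrasowskiiSolution_mem_omegaLimit [FiniteDimensional ℝ X] {F : X → X} {x : ℝ → X}
    (hx : IsKrasowskiiSolution F ⊤ x) {K : Set X} (hK : IsCompact K) (hxK : ∀ t, 0 ≤ t → x t ∈ K)
    {M : ℝ≥0} (hM : ∀ r : ℝ, 0 ≤ r → ∀ᶠ y in 𝓝 (x r), ‖F y‖ ≤ M) {p : X}
    (hp : MapClusterPt p atTop x) :
    ∃ y : ℝ → X, IsKrasowskiiSolution F ⊤ y ∧ y 0 = p ∧
      ∀ s, 0 ≤ s → MapClusterPt (y s) atTop x := by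
  obtain ⟨U, hU, hUp⟩ := mapClusterPt_iff_ultrafilter.1 hp
  have hconv : ∀ s : ℝ, ∃ q, 0 ≤ s → Tendsto (fun i => x (i + s)) U (𝓝 q) := by
    intro s
    by_cases hs : 0 ≤ s
    · obtain ⟨q, hq⟩ := hK.exists_tendsto_ultrafilter (U := U) (x := fun i => x (i + s)) <| by
        filter_upwards [hU (eventually_ge_atTop 0)] with i hi using hxK _ (add_nonneg hi hs)
      exact ⟨q, fun _ => hq⟩
    · exact ⟨0, fun h => absurd h hs⟩
  choose y hy using hconv
  refine ⟨y, (isKrasowskiiSolution_of_tendsto (M := M) EReal.zero_lt_top (U := (U : Filter ℝ))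
    (x := fun i t => x (i + t)) (fun t ht _ => hy t ht) ?_ ?_).2, ?_, fun s hs => ?_⟩
  · intro s t hs hst _
    filter_upwards [hU (eventually_ge_atTop 0)] with i hi
    have := hx.dist_le (add_nonneg hi hs) (add_le_add_right hst i) (EReal.coe_lt_top _)
      fun r hr _ => hM r hr
    rwa [add_sub_add_left_eq_sub] at this
  · intro s t hs hst _ δ hδ
    filter_upwards [hU (eventually_ge_atTop 0)] with i hi
    have := hx.slope_mem (δ := δ) (M := M) (add_nonneg hi hs) (add_lt_add_right hst i)
      (EReal.coe_lt_top _) (fun r hr _ => hM r hr) (by rwa [add_sub_add_left_eq_sub])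
    rwa [add_sub_add_left_eq_sub] at this
  · have h := hy 0 le_rfl
    simp only [add_zero] at h
    exact tendsto_nhds_unique h hUp
  · refine mapClusterPt_iff_ultrafilter.2 ⟨U.map (fun i => i + s), ?_, hy s hs⟩
    exact (tendsto_atTop_add_const_right _ s tendsto_id).mono_left hU

/-- Times at which `x` stays farther than ε from the ω-limit set would, by compactness, accumulate
at a point of that set. The argument also excludes an empty ω-limit set. -/
theorem convergesTo_omegaLimit {X : Type*} [NormedAddCommGroup X] {x : ℝ → X} {K : Set X}
    (hK : IsCompact K) (hxK : ∀ t, 0 ≤ t → x t ∈ K) : ConvergesTo x {p | MapClusterPt p atTop x} := by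
  refine ENNReal.tendsto_nhds_zero.2 fun ε hε => ?_
  by_contra hcon
  have hne := frequently_iff_neBot.1 (not_eventually.1 hcon)
  let U := Ultrafilter.of (atTop ⊓ 𝓟 {t | ¬Metric.infEDist (x t) {p | MapClusterPt p atTop x} ≤ ε})
  obtain ⟨hU, hUn⟩ := le_inf_iff.1 (Ultrafilter.of_le
    (atTop ⊓ 𝓟 {t | ¬Metric.infEDist (x t) {p | MapClusterPt p atTop x} ≤ ε}))
  rw [le_principal_iff] at hUn
  obtain ⟨p, hp⟩ := hK.exists_tendsto_ultrafilter (U := U) (x := x) <| by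
    filter_upwards [hU (eventually_ge_atTop 0)] with t ht using hxK t ht
  have hpΩ : p ∈ {p | MapClusterPt p atTop x} :=
    mapClusterPt_iff_ultrafilter.2 ⟨U, hU, hp⟩
  have hlt : ∀ᶠ t in (U : Filter ℝ), edist (x t) p < ε :=
    hp.eventually (Metric.eball_mem_nhds p hε)
  obtain ⟨t, h1, h2⟩ := (hlt.and (show ∀ᶠ t in (U : Filter ℝ), _ from hUn)).exists
  exact h2 ((Metric.infEDist_le_edist_of_mem hpΩ).trans h1.le)

/-- **LaSalle's invariance principle** for Krasowskii solutions. -/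
theorem IsMaximalKrasowskiiSolution.convergesTo_largestWeaklyInvariantSubset
    [FiniteDimensional ℝ X] {F : X → X} {T : EReal} {x : ℝ → X}
    (hx : IsMaximalKrasowskiiSolution F T x)
    (hF : ∀ R : ℝ, ∃ M : ℝ≥0, ∀ y, ‖y‖ ≤ R → ‖F y‖ ≤ M)
    {V : X → ℝ} (hV : ContDiff ℝ 1 V) (hVtop : Tendsto V (cocompact X) atTop)
    (hdec : ∀ y, ∀ v ∈ krasowskii F y, fderiv ℝ V y v ≤ 0) {A : Set X} (hA : IsClosed A)
    (hdecA : ∀ y ∉ A, ∀ v ∈ krasowskii F y, fderiv ℝ V y v < 0) :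
    T = ⊤ ∧ ConvergesTo x (largestWeaklyInvariantSubset F A) := by
  have hsol := hx.isSolution
  obtain ⟨K, hK, hKV⟩ := mem_cocompact.1 (hVtop.eventually_gt_atTop (V (x 0)))
  have hxK : ∀ t : ℝ, 0 ≤ t → (t : EReal) < T → x t ∈ K := fun t h0 h1 => by
    by_contra hmem
    exact (hsol.lyapunov_le hV hdec le_rfl h0 h1).not_gt (hKV hmem)
  obtain ⟨R, hR⟩ := hK.isBounded.exists_norm_le
  obtain ⟨M, hM⟩ := hF (R + 1)
  have hM' : ∀ r : ℝ, 0 ≤ r → (r : EReal) < T → ∀ᶠ y in 𝓝 (x r), ‖F y‖ ≤ M := by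
    intro r h0 h1
    filter_upwards [continuous_norm.continuousAt.eventually_lt_const
      (lt_of_le_of_lt (hR _ (hxK r h0 h1)) (lt_add_one R))] with y hy using hM y hy.le
  obtain rfl : T = ⊤ := hx.eq_top hF hM'
  refine ⟨rfl, ?_⟩
  replace hM' := fun r hr => hM' r hr (EReal.coe_lt_top r)
  replace hxK := fun t ht => hxK t ht (EReal.coe_lt_top t)
  obtain ⟨c, hc⟩ : ∃ c, Tendsto (fun t => V (x t)) atTop (𝓝 c) := by
    -- Values of `x` at negative times are arbitrary, hence the truncation.
    have hanti : Antitone fun t => V (x (max t 0)) := fun s t hst =>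
      hsol.lyapunov_le hV hdec (le_max_right _ _) (max_le_max_right 0 hst) (EReal.coe_lt_top _)
    have hbdd : BddBelow (range fun t => V (x (max t 0))) := by
      refine (hK.bddBelow_image hV.continuous.continuousOn).mono ?_
      rintro _ ⟨t, rfl⟩
      exact mem_image_of_mem V (hxK _ (le_max_right _ _))
    refine ⟨_, (tendsto_atTop_ciInf hanti hbdd).congr' ?_⟩
    filter_upwards [eventually_ge_atTop 0] with t ht
    rw [max_eq_left ht]
  have hconst : ∀ p, MapClusterPt p atTop x → V p = c := fun p hp => by
    obtain ⟨U, hU, hUp⟩ := mapClusterPt_iff_ultrafilter.1 hp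
    exact tendsto_nhds_unique ((hV.continuous.tendsto p).comp hUp) (hc.mono_left hU)
  have hsub : {p | MapClusterPt p atTop x} ⊆ largestWeaklyInvariantSubset F A := by
    refine subset_sUnion_of_mem ⟨fun p hp => ?_, fun p hp => ?_⟩
    · obtain ⟨y, hy, hy0, hyΩ⟩ := exists_isKrasowskiiSolution_mem_omegaLimit hsol hK hxK hM' hp
      -- A solution on [0, ∞) is automatically maximal.
      exact ⟨⊤, y, ⟨hy, fun T' _ _ hT' _ => top_le_iff.1 hT'⟩, hy0, fun t ht _ => hyΩ t ht⟩
    · obtain ⟨y, hy, hy0, hyΩ⟩ := exists_isKrasowskiiSolution_mem_omegaLimit hsol hK hxK hM' hp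
      rw [← hy0]
      exact hy.mem_of_lyapunov_const hV hA hdecA fun r hr _ => hconst _ (hyΩ r hr.le)
  exact tendsto_of_tendsto_of_tendsto_of_le_of_le tendsto_const_nhds
    (convergesTo_omegaLimit hK hxK) (fun _ => zero_le) fun t => Metric.infEDist_anti hsub

end Inclusion

/-! ### The quantizer -/

theorem abs_quantizer_le {Δ : ℝ} (hΔ : 0 < Δ) (r : ℝ) : |quantizer Δ r| ≤ |r| + Δ := by
  have h1 := Int.floor_le (r / Δ + 1 / 2)
  have h2 := Int.lt_floor_add_one (r / Δ + 1 / 2)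
  have h3 : Δ * (r / Δ + 1 / 2) = r + Δ / 2 := by field_simp
  have h4 := mul_le_mul_of_nonneg_left h1 hΔ.le
  have h5 := mul_le_mul_of_nonneg_left h2.le hΔ.le
  rw [h3] at h4 h5
  rw [mul_add, mul_one] at h5
  unfold quantizer
  rw [abs_le]
  constructor <;> linarith [le_abs_self r, neg_abs_le r]

theorem mul_quantizer_nonneg {Δ : ℝ} (hΔ : 0 < Δ) (r : ℝ) : 0 ≤ r * quantizer Δ r := by
  unfold quantizer
  rcases le_total 0 r with hr | hr
  · have : (0 : ℤ) ≤ ⌊r / Δ + 1 / 2⌋ := Int.floor_nonneg.2 (by positivity)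
    have : (0 : ℝ) ≤ ⌊r / Δ + 1 / 2⌋ := by exact_mod_cast this
    positivity
  · have h1 : r / Δ + 1 / 2 < 1 := by linarith [div_nonpos_of_nonpos_of_nonneg hr hΔ.le]
    have : ⌊r / Δ + 1 / 2⌋ ≤ 0 := Int.lt_add_one_iff.1 (Int.floor_lt.2 (by simpa using h1))
    have : (⌊r / Δ + 1 / 2⌋ : ℝ) ≤ 0 := by exact_mod_cast this
    exact mul_nonneg_of_nonpos_of_nonpos hr (mul_nonpos_of_nonneg_of_nonpos hΔ.le this)

/-- Beyond the threshold the quantizer has the sign of `r` and modulus at least one step Δ. The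
resulting bound is uniform, so strict decrease survives the closure in 𝒦F. -/
theorem le_mul_quantizer {Δ : ℝ} (hΔ : 0 < Δ) {r : ℝ} (hr : Δ / 2 < |r|) :
    Δ ^ 2 / 2 ≤ r * quantizer Δ r := by
  unfold quantizer
  rcases lt_abs.1 hr with hr | hr
  · have h1 : 1 / 2 < r / Δ := by
      rw [lt_div_iff₀ hΔ]
      linarith
    have : (1 : ℤ) ≤ ⌊r / Δ + 1 / 2⌋ := Int.le_floor.2 (by push_cast; linarith)
    have h2 : (1 : ℝ) ≤ ⌊r / Δ + 1 / 2⌋ := by exact_mod_cast this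
    nlinarith [mul_le_mul_of_nonneg_left h2 hΔ.le]
  · have h1 : r / Δ < -(1 / 2) := by
      rw [div_lt_iff₀ hΔ]
      linarith
    have : ⌊r / Δ + 1 / 2⌋ < 0 := Int.floor_lt.2 (by push_cast; linarith)
    have h2 : (⌊r / Δ + 1 / 2⌋ : ℝ) ≤ -1 := by exact_mod_cast Int.le_sub_one_of_lt this
    nlinarith [mul_le_mul_of_nonneg_left h2 hΔ.le]

/-! ### The closed loop -/

section ClosedLoop

variable {N M p : ℕ} {n : Fin N → ℕ}

theorem continuous_relativeOutput (D : Matrix (Fin N) (Fin M) ℝ)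
    {h : ∀ i, (Fin (n i) → ℝ) → (Fin p → ℝ)} (hh : ∀ i, Continuous (h i)) :
    Continuous (relativeOutput D h) := by
  have : Continuous (stackedOutput h) := continuous_pi fun a =>
    (continuous_apply a.2).comp ((hh a.1).comp (continuous_apply a.1))
  exact continuous_const.matrix_mulVec this

theorem isClosed_practicalSyncSet (Δ : ℝ) (D : Matrix (Fin N) (Fin M) ℝ)
    {h : ∀ i, (Fin (n i) → ℝ) → (Fin p → ℝ)} (hh : ∀ i, Continuous (h i)) :
    IsClosed (practicalSyncSet Δ D h) := by
  simp only [practicalSyncSet, ofPred_forall]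
  exact isClosed_iInter fun k => isClosed_iInter fun j => isClosed_le
    ((continuous_apply (k, j)).comp (continuous_relativeOutput D hh)).abs continuous_const

/-- Only local boundedness is available, since the quantizer jumps; written as O(1), it is stable
under the sums and products defining the loop. -/
theorem closedLoop_isBigO_one {Δ : ℝ} (hΔ : 0 < Δ) (D : Matrix (Fin N) (Fin M) ℝ)
    {f : ∀ i, (Fin (n i) → ℝ) → (Fin (n i) → ℝ)}
    {g : ∀ i, (Fin (n i) → ℝ) → Matrix (Fin (n i)) (Fin p) ℝ}
    {h : ∀ i, (Fin (n i) → ℝ) → (Fin p → ℝ)} (hf : ∀ i, Continuous (f i))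
    (hg : ∀ i a b, Continuous fun ξ => g i ξ a b) (hh : ∀ i, Continuous (h i))
    (ξ : ∀ i, Fin (n i) → ℝ) :
    closedLoop Δ D f g h =O[𝓝 ξ] fun _ => (1 : ℝ) := by
  have hq : ∀ b, (fun ξ => quantizer Δ (relativeOutput D h ξ b)) =O[𝓝 ξ] fun _ => (1 : ℝ) := by
    intro b
    have hc : Continuous fun ξ => |relativeOutput D h ξ b| + Δ :=
      ((continuous_apply b).comp (continuous_relativeOutput D hh)).abs.add continuous_const
    refine (Asymptotics.IsBigO.of_bound 1 (Eventually.of_forall fun ζ => ?_)).trans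
      (hc.continuousAt.isBigO_one ℝ)
    rw [one_mul, Real.norm_eq_abs, Real.norm_of_nonneg (by positivity)]
    exact abs_quantizer_le hΔ _
  have hu : ∀ a, (fun ξ => quantizedControl Δ D h ξ a) =O[𝓝 ξ] fun _ => (1 : ℝ) := by
    intro a
    simp only [quantizedControl, Pi.neg_apply, Matrix.mulVec, dotProduct]
    exact (Asymptotics.IsBigO.fun_sum fun b _ => (hq b).const_mul_left _).neg_left
  refine Asymptotics.isBigO_pi.2 fun i => Asymptotics.isBigO_pi.2 fun a => ?_
  simp only [closedLoop, Pi.add_apply, Matrix.mulVec, dotProduct]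
  have hfc : Continuous fun ξ : ∀ i, Fin (n i) → ℝ => f i (ξ i) a :=
    (continuous_apply a).comp ((hf i).comp (continuous_apply i))
  refine (hfc.continuousAt.isBigO_one ℝ).add (Asymptotics.IsBigO.fun_sum fun j _ => ?_)
  have hgc : Continuous fun ξ : ∀ i, Fin (n i) → ℝ => g i (ξ i) a j :=
    (hg i a j).comp (continuous_apply i)
  simpa using (hgc.continuousAt.isBigO_one ℝ).mul (hu (i, j))

theorem exists_bound_of_isBigO_one {X : Type*} [NormedAddCommGroup X] [ProperSpace X] {F : X → X}
    (hF : ∀ x, F =O[𝓝 x] fun _ => (1 : ℝ)) (R : ℝ) : ∃ M : ℝ≥0, ∀ y, ‖y‖ ≤ R → ‖F y‖ ≤ M := by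
  have h : ∃ M : ℝ, ∀ y ∈ Metric.closedBall (0 : X) R, ‖F y‖ ≤ M := by
    refine (isCompact_closedBall (0 : X) R).induction_on (p := fun s => ∃ M : ℝ, ∀ y ∈ s, ‖F y‖ ≤ M)
      ⟨0, by simp⟩ (fun s t hst ⟨M, hM⟩ => ⟨M, fun y hy => hM y (hst hy)⟩) ?_ ?_
    · rintro s t ⟨M, hM⟩ ⟨M', hM'⟩
      refine ⟨max M M', fun y hy => ?_⟩
      rcases hy with hy | hy
      · exact (hM y hy).trans (le_max_left _ _)
      · exact (hM' y hy).trans (le_max_right _ _)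
    · intro x _
      obtain ⟨c, hc⟩ := (hF x).bound
      exact ⟨_, nhdsWithin_le_nhds hc, c, fun y hy => by simpa using hy⟩
  obtain ⟨M, hM⟩ := h
  exact ⟨M.toNNReal, fun y hy => (hM y (by simpa using hy)).trans (Real.le_coe_toNNReal M)⟩

/-- Moving D ⊗ I across the pairing turns the outputs into z; the supplied power is thus -zᵀ q_Δ(z).
-/
theorem stackedOutput_dotProduct_quantizedControl (Δ : ℝ) (D : Matrix (Fin N) (Fin M) ℝ)
    (h : ∀ i, (Fin (n i) → ℝ) → (Fin p → ℝ)) (ξ : ∀ i, Fin (n i) → ℝ) :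
    stackedOutput h ξ ⬝ᵥ quantizedControl Δ D h ξ =
      -∑ b, relativeOutput D h ξ b * quantizer Δ (relativeOutput D h ξ b) := by
  rw [quantizedControl, dotProduct_neg, Matrix.dotProduct_mulVec, ← Matrix.mulVec_transpose,
    ← Matrix.kroneckerMap_transpose, Matrix.transpose_one]
  rfl

/-- The total storage decreases along the closed loop at least at the rate `zᵀ q_Δ(z)`. -/
theorem fderiv_sum_storage_le (Δ : ℝ) (D : Matrix (Fin N) (Fin M) ℝ)
    {f : ∀ i, (Fin (n i) → ℝ) → (Fin (n i) → ℝ)}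
    {g : ∀ i, (Fin (n i) → ℝ) → Matrix (Fin (n i)) (Fin p) ℝ}
    {h : ∀ i, (Fin (n i) → ℝ) → (Fin p → ℝ)} {S : ∀ i, (Fin (n i) → ℝ) → ℝ}
    (hS : ∀ i, ContDiff ℝ 1 (S i))
    (hpass : ∀ i (ξ : Fin (n i) → ℝ) (u : Fin p → ℝ),
      fderiv ℝ (S i) ξ (f i ξ + g i ξ *ᵥ u) ≤ h i ξ ⬝ᵥ u) (ξ : ∀ i, Fin (n i) → ℝ) :
    fderiv ℝ (fun ξ : ∀ i, Fin (n i) → ℝ => ∑ i, S i (ξ i)) ξ (closedLoop Δ D f g h ξ) ≤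
      -∑ b, relativeOutput D h ξ b * quantizer Δ (relativeOutput D h ξ b) := by
  have hd : HasFDerivAt (fun ξ : ∀ i, Fin (n i) → ℝ => ∑ i, S i (ξ i))
      (∑ i, (fderiv ℝ (S i) (ξ i)).comp
        (ContinuousLinearMap.proj (R := ℝ) (φ := fun i => Fin (n i) → ℝ) i)) ξ :=
    HasFDerivAt.fun_sum fun i _ =>
      HasFDerivAt.comp ξ ((hS i).differentiable one_ne_zero).differentiableAt.hasFDerivAt
        (hasFDerivAt_apply i ξ)
  rw [hd.fderiv, ← stackedOutput_dotProduct_quantizedControl, dotProduct, Fintype.sum_prod_type]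
  simp only [FunLike.coe_sum, Finset.sum_apply, ContinuousLinearMap.comp_apply,
    ContinuousLinearMap.proj_apply]
  exact Finset.sum_le_sum fun i _ => hpass i (ξ i) _

/-- Going to infinity in the product is covered by the cases where one factor does; that summand
then bounds the nonnegative sum from below. -/
theorem tendsto_sum_cocompact {S : ∀ i, (Fin (n i) → ℝ) → ℝ} (hS : ∀ i ξ, 0 ≤ S i ξ)
    (htop : ∀ i, Tendsto (S i) (cocompact _) atTop) :
    Tendsto (fun ξ : ∀ i, Fin (n i) → ℝ => ∑ i, S i (ξ i)) (cocompact _) atTop := by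
  rw [← Filter.coprodᵢ_cocompact, Filter.coprodᵢ, tendsto_iSup]
  intro i
  refine tendsto_atTop_mono (fun ξ => ?_) ((htop i).comp tendsto_comap)
  exact Finset.single_le_sum (f := fun i => S i (ξ i)) (fun j _ => hS j (ξ j)) (Finset.mem_univ i)

end ClosedLoop

end QuantizedSync

theorem mainTheorem6 {N M p : ℕ} {n : Fin N → ℕ}
    (G : SimpleGraph (Fin N)) (hG : G.Connected)
    (pos neg : Fin M → Fin N) (hlab : QuantizedSync.IsEdgeLabelling G pos neg)
    (f : ∀ i, (Fin (n i) → ℝ) → (Fin (n i) → ℝ))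
    (g : ∀ i, (Fin (n i) → ℝ) → Matrix (Fin (n i)) (Fin p) ℝ)
    (h : ∀ i, (Fin (n i) → ℝ) → (Fin p → ℝ))
    (hadm : ∀ i, QuantizedSync.IsAdmissibleAgent (f i) (g i) (h i))
    (hpassive : ∀ i, QuantizedSync.IsPassiveAgent (f i) (g i) (h i))
    (Δ : ℝ) (hΔ : 0 < Δ)
    (T : EReal) (ξ : ℝ → ∀ i, Fin (n i) → ℝ)
    (hξ : QuantizedSync.IsMaximalKrasowskiiSolution
      (QuantizedSync.closedLoop Δ (QuantizedSync.incidence pos neg) f g h) T ξ) :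
    T = ⊤ ∧
      QuantizedSync.ConvergesTo ξ
        (QuantizedSync.largestWeaklyInvariantSubset
          (QuantizedSync.closedLoop Δ (QuantizedSync.incidence pos neg) f g h)
          (QuantizedSync.practicalSyncSet Δ (QuantizedSync.incidence pos neg) h)) := by
  open QuantizedSync Filter Topology Set in
  set D := incidence pos neg
  choose S W hS hS0 hSpos hStop _ hW _ hpass using hpassive
  have hSnn : ∀ i ζ, 0 ≤ S i ζ := fun i ζ => by
    by_cases hζ : ζ = 0
    · rw [hζ, hS0]
    · exact (hSpos i ζ hζ).le
  have hh := fun i => (hadm i).lipschitz_h.continuous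
  have hbigO := closedLoop_isBigO_one hΔ D (fun i => (hadm i).lipschitz_f.continuous)
    (fun i a b => ((hadm i).lipschitz_g a b).continuous) hh
  have hV : ContDiff ℝ 1 fun ζ : ∀ i, Fin (n i) → ℝ => ∑ i, S i (ζ i) :=
    ContDiff.sum fun i _ => (hS i).comp 
      (ContinuousLinearMap.proj (R := ℝ) (φ := fun i => Fin (n i) → ℝ) i).contDiff
  have hdecay := fderiv_sum_storage_le Δ D hS
    fun i ζ u => (hpass i ζ u).trans (by linarith [hW i ζ])
  have hbound : ∀ ζ, ∃ C, ∀ᶠ y in 𝓝 ζ, ‖closedLoop Δ D f g h y‖ ≤ C := fun ζ => by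
    obtain ⟨C, hC⟩ := (hbigO ζ).bound
    exact ⟨C, by simpa using hC⟩
  have hnn : ∀ ζ b, 0 ≤ relativeOutput D h ζ b * quantizer Δ (relativeOutput D h ζ b) :=
    fun ζ b => mul_quantizer_nonneg hΔ _
  refine hξ.convergesTo_largestWeaklyInvariantSubset (exists_bound_of_isBigO_one hbigO) hV
    (tendsto_sum_cocompact hSnn hStop) (fun ζ v hv => ?_)
    (isClosed_practicalSyncSet Δ D hh) (fun ζ hζ v hv => ?_)
  · obtain ⟨C, hC⟩ := hbound ζ
    refine fderiv_le_of_mem_krasowskii hV hv hC (Eventually.of_forall fun y => ?_)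
    exact (hdecay y).trans (neg_nonpos.2 (Finset.sum_nonneg fun b _ => hnn y b))
  · obtain ⟨C, hC⟩ := hbound ζ
    simp only [practicalSyncSet, mem_ofPred_eq, not_forall, not_le] at hζ
    obtain ⟨k, j, hkj⟩ := hζ
    -- The strict threshold persists near ζ, so the single entry (k, j) forces the rate Δ²/2 on a
    -- whole neighbourhood.
    have hev : ∀ᶠ y in 𝓝 ζ, Δ / 2 < |relativeOutput D h y (k, j)| :=
      ((continuous_apply (k, j)).comp
        (continuous_relativeOutput D hh)).abs.continuousAt.eventually_const_lt hkj
    have hle : fderiv ℝ (fun ζ : ∀ i, Fin (n i) → ℝ => ∑ i, S i (ζ i)) ζ v ≤ -(Δ ^ 2 / 2) := by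
      refine fderiv_le_of_mem_krasowskii hV hv hC ?_
      filter_upwards [hev] with y hy
      refine (hdecay y).trans (neg_le_neg ((le_mul_quantizer hΔ hy).trans ?_))
      exact Finset.single_le_sum
        (f := fun b => relativeOutput D h y b * quantizer Δ (relativeOutput D h y b))
        (fun b _ => hnn y b) (Finset.mem_univ (k, j))
    have : 0 < Δ ^ 2 / 2 := by positivity
    linarith
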